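/- Let $A$ be a finite set and let $\Sigma_A$ be the group of permutations of $A$. A strict partial order $<$ on $A$ is \emph{semi-linear} if there are $l\ge 0$ and a surjection $h:A\to\{1,\dots,l\}$ with $a<b\iff h(a)<h(b)$. A \emph{double order} on $A$ is a pair $d=(<^x,<^y)$ of strict partial orders on $A$ such that any two distinct elements of $A$ are comparable by $<^x$ or by $<^y$. It is \emph{regular} if $<^x$ is semi-linear and no two elements of $A$ are comparable by both $<^x$ and $<^y$; it is \emph{semi-regular} if there are finitely many (at least one) regular double orders $d_1,\dots,d_k$ such that $<^x$ is the transitive closure of $\bigcup_i <^x_i$ and $<^y$ is the transitive closure of $\bigcup_i <^y_i$. Let $R(A)$ and $R^+(A)$ be the sets of regular and of semi-regular double orders on $A$. The group $\Sigma_A$ acts on both from the right by $d\sigma=(<^x\sigma,<^y\sigma)$, where $a\,({<}\sigma)\,b\iff\sigma(a)<\sigma(b)$. Define $$d_1\subseteq d_2\iff {<^x_1}\subseteq{<^x_2}\text{ and }{<^y_1}\subseteq{<^y_2},\qquad d_1\sqsubseteq d_2\iff {<^x_1}\subseteq{<^x_2}\text{ and }{<^y_1}\supseteq{<^y_2}.$$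 For strict partial orders $<_1,<_2$ let $a\,({<_1}\setminus{<_2})\,b$ mean that $a<_1b$ and that $a,b$ are not comparable by $<_2$. Then $$F:(R^+(A),\subseteq)\to(R(A),\sqsubseteq),\qquad F(<^x,<^y)=(<^x,\ {<^y}\setminus{<^x})$$ is an order-preserving map. For a poset $P$ let $|P|$ be the geometric realization of its order complex, and let $\mathrm{sd}(P)$ be the poset of non-empty finite chains of $P$ ordered by inclusion. Then $$G:\mathrm{sd}(R(A),\sqsubseteq)\to(R^+(A),\subseteq),\qquad G(d_0\sqsubset d_1\sqsubset\dots\sqsubset d_r)=\bigcup_{i=0}^r d_i=(<^x_r,<^y_0)$$ is an order-preserving map as well. \textbf{Proposition.} The map $|F|:|(R^+(A),\subseteq)|\to|(R(A),\sqsubseteq)|$ and the composite $$|(R(A),\sqsubseteq)|\cong|\mathrm{sd}(R(A),\sqsubseteq)|\xrightarrow{\ |G|\ }|(R^+(A),\subseteq)|,$$ whose first map is the inverse of the canonical homeomorphism $|\mathrm{sd}(P)|\to|P|$ (which sends the vertex $c$ to the barycenter of the simplex spanned by the chain $c$ and is affine on simplices), are mutually inverse $\Sigma_A$-homotopy equivalences: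 both are $\Sigma_A$-equivariant, and both of their composites are homotopic to the respective identity maps through $\Sigma_A$-equivariant maps. -/

import Mathlib

/-! ## Geometric realization of finite posets and barycentric subdivision -/

/-- The geometric realization `|P|` of a finite poset `P` (the realization of its order complex), in
barycentric coordinates: formal convex combinations of elements of `P` whose support is a chain,
with the subspace topology from `P → ℝ`. -/
def PosetRealization (P : Type*) [Fintype P] [PartialOrder P] : Type _ :=
  {x : stdSimplex ℝ P // IsChain (· ≤ ·) {p : P | x p ≠ 0}}

namespace PosetRealization

instance (P : Type*) [Fintype P] [PartialOrder P] : TopologicalSpace (PosetRealization P) :=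
  instTopologicalSpaceSubtype

/-- The barycentric coordinate of a point of `|P|` at an element of `P`. -/
def coord {P : Type*} [Fintype P] [PartialOrder P] (x : PosetRealization P) (p : P) : ℝ :=
  x.1 p

theorem coord_injective {P : Type*} [Fintype P] [PartialOrder P] :
    Function.Injective (coord : PosetRealization P → P → ℝ) := by
  intro x y h
  exact Subtype.ext (stdSimplex.ext h)

theorem continuous_coord {P : Type*} [Fintype P] [PartialOrder P] :
    Continuous (coord : PosetRealization P → P → ℝ) :=
  continuous_subtype_val.comp continuous_subtype_val

instance (P : Type*) [Fintype P] [PartialOrder P] : T2Space (PosetRealization P) :=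
  inferInstanceAs
    (T2Space {x : stdSimplex ℝ P // IsChain (· ≤ ·) {p : P | x p ≠ 0}})

instance (P : Type*) [Fintype P] [PartialOrder P] : CompactSpace (PosetRealization P) := by
  have h : {x : stdSimplex ℝ P | IsChain (· ≤ ·) {p : P | x p ≠ 0}} =
      ⋂ (p : P) (q : P) (_ : ¬ (p ≤ q ∨ q ≤ p)), {x : stdSimplex ℝ P | x p * x q = 0} := by
    ext x
    simp only [Set.mem_iInter, Set.mem_ofPred_eq]
    constructor
    · intro hx p q hpq
      by_contra h0
      have h1 := left_ne_zero_of_mul h0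
      have h2 := right_ne_zero_of_mul h0
      exact hpq (hx.total h1 h2)
    · intro hx p hp q hq _
      by_contra hpq
      exact mul_ne_zero hp hq (hx p q hpq)
  have hc : IsClosed {x : stdSimplex ℝ P | IsChain (· ≤ ·) {p : P | x p ≠ 0}} := by
    rw [h]
    refine isClosed_iInter fun p => isClosed_iInter fun q => isClosed_iInter fun _ => ?_
    have hp : ∀ r : P, Continuous fun x : stdSimplex ℝ P => x r := fun r =>
      (continuous_apply r).comp continuous_subtype_val
    exact isClosed_eq ((hp p).mul (hp q)) continuous_const
  exact isCompact_iff_compactSpace.mp hc.isCompact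

/-- The map `|f| : |P| → |Q|` induced by an order-preserving map `f : P → Q`: the affine extension
of `f` over the simplices, i.e. the coordinate of `|f| x` at `q` is the sum of the coordinates of
`x` over the fibre of `f` at `q`. -/
noncomputable def map {P Q : Type*} [Fintype P] [PartialOrder P] [Fintype Q] [PartialOrder Q]
    (f : P →o Q) : C(PosetRealization P, PosetRealization Q) where
  toFun x := ⟨stdSimplex.map f x.1, by
    have key : ∀ q, (stdSimplex.map f x.1) q ≠ 0 → ∃ p, x.1 p ≠ 0 ∧ f p = q := by
      classical
      intro q hq
      rw [stdSimplex.map_coe, FunOnFinite.linearMap_apply_apply] at hq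
      obtain ⟨p, hp, hne⟩ := Finset.exists_ne_zero_of_sum_ne_zero hq
      exact ⟨p, hne, by simpa using hp⟩
    intro a ha b hb _
    obtain ⟨p, hp, rfl⟩ := key a ha
    obtain ⟨q, hq, rfl⟩ := key b hb
    exact (x.2.total hp hq).imp (fun h => f.monotone h) (fun h => f.monotone h)⟩
  continuous_toFun :=
    ((stdSimplex.continuous_map (S := ℝ) f).comp continuous_subtype_val).subtype_mk _

/-- The translation by a group element as an order-preserving map. -/
def smulHom {G P : Type*} [Group G] [PartialOrder P] [MulAction G P]
    [CovariantClass G P (· • ·) (· ≤ ·)] (g : G) : P →o P where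
  toFun p := g • p
  monotone' _ _ h := CovariantClass.elim g h

/-- The action on `|P|` induced by an order-preserving action on `P`. -/
noncomputable instance {G P : Type*} [Group G] [Fintype P] [PartialOrder P] [MulAction G P]
    [CovariantClass G P (· • ·) (· ≤ ·)] : MulAction G (PosetRealization P) where
  smul g x := map (smulHom g) x
  one_smul x := Subtype.ext <| by
    have h : ((smulHom (1 : G) : P →o P) : P → P) = id := funext fun p => one_smul G p
    change stdSimplex.map (smulHom (1 : G) : P →o P) x.1 = x.1
    rw [h, stdSimplex.map_id_apply]
  mul_smul g g' x := Subtype.ext <| by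
    have h : ((smulHom (g * g') : P →o P) : P → P) =
        (smulHom g : P →o P) ∘ (smulHom g' : P →o P) := funext fun p => mul_smul g g' p
    change stdSimplex.map (smulHom (g * g') : P →o P) x.1 =
      stdSimplex.map (smulHom g : P →o P) (stdSimplex.map (smulHom g' : P →o P) x.1)
    rw [h, stdSimplex.map_comp_apply]

end PosetRealization

/-- The barycentric subdivision of a poset: its nonempty finite chains, ordered by inclusion. -/
abbrev PosetSd (P : Type*) [PartialOrder P] : Type _ := PartialOrder.NonemptyFiniteChains P

namespace PosetSd

noncomputable instance (P : Type*) [Fintype P] [PartialOrder P] : Fintype (PosetSd P) :=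
  @Fintype.ofFinite _ (Finite.of_injective
    (PartialOrder.NonemptyFiniteChains.finset : PosetSd P → Finset P)
    (fun _ _ h => PartialOrder.NonemptyFiniteChains.ext h))

section

theorem card_pos {P : Type*} [PartialOrder P] (c : PosetSd P) :
    (0 : ℝ) < (c.finset.card : ℝ) := by
  exact_mod_cast c.nonempty.card_pos

variable {P : Type*} [Fintype P] [PartialOrder P]

open scoped Classical in
/-- For weights `y` on chains, the combination of the barycenters of the chains with weights `y`:
each chain `c` distributes its weight equally among its elements. -/
noncomputable def baryFun (y : PosetSd P → ℝ) (p : P) : ℝ :=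
  ∑ c : PosetSd P, if p ∈ c.finset then y c / (c.finset.card : ℝ) else 0

theorem baryFun_nonneg {y : PosetSd P → ℝ} (hy : ∀ c, 0 ≤ y c) (p : P) : 0 ≤ baryFun y p := by
  classical
  refine Finset.sum_nonneg fun c _ => ?_
  split_ifs
  · exact div_nonneg (hy c) (card_pos c).le
  · exact le_rfl

theorem sum_baryFun (y : PosetSd P → ℝ) : ∑ p, baryFun y p = ∑ c, y c := by
  classical
  unfold baryFun
  rw [Finset.sum_comm]
  refine Finset.sum_congr rfl fun c _ => ?_
  rw [Finset.sum_ite_mem, Finset.univ_inter, Finset.sum_const, nsmul_eq_mul]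
  have := card_pos c
  field_simp

theorem exists_of_baryFun_ne_zero {y : PosetSd P → ℝ} {p : P} (h : baryFun y p ≠ 0) :
    ∃ c : PosetSd P, y c ≠ 0 ∧ p ∈ c.finset := by
  classical
  obtain ⟨c, -, hc⟩ := Finset.exists_ne_zero_of_sum_ne_zero h
  by_cases hp : p ∈ c.finset
  · rw [if_pos hp] at hc
    exact ⟨c, fun h0 => hc (by simp [h0]), hp⟩
  · rw [if_neg hp] at hc
    exact absurd rfl hc

theorem isChain_baryFun {y : PosetSd P → ℝ} (hy : IsChain (· ≤ ·) {c | y c ≠ 0}) :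
    IsChain (· ≤ ·) {p | baryFun y p ≠ 0} := by
  intro p hp q hq _
  obtain ⟨c, hc, hpc⟩ := exists_of_baryFun_ne_zero hp
  obtain ⟨d, hd, hqd⟩ := exists_of_baryFun_ne_zero hq
  rcases hy.total hc hd with h | h
  · exact d.comparable ⟨p, h hpc⟩ ⟨q, hqd⟩
  · exact c.comparable ⟨p, hpc⟩ ⟨q, h hqd⟩

theorem exists_mem_forall_le {y : PosetSd P → ℝ} (hy : IsChain (· ≤ ·) {c | y c ≠ 0})
    (C : PosetSd P) :
    ∃ p ∈ C.finset, ∀ c : PosetSd P, y c ≠ 0 → p ∈ c.finset → C ≤ c := by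
  classical
  set N : Finset (PosetSd P) := {c | y c ≠ 0 ∧ ¬ C ≤ c} with hN
  rcases N.eq_empty_or_nonempty with h0 | hne
  · obtain ⟨p, hp⟩ := C.nonempty
    refine ⟨p, hp, fun c hc _ => ?_⟩
    by_contra hcc
    have : c ∈ N := by simp only [hN, Finset.mem_filter_univ]; exact ⟨hc, hcc⟩
    simp [h0] at this
  · obtain ⟨M, hM, hmax⟩ := N.exists_maximal hne
    have hM' : y M ≠ 0 ∧ ¬ C ≤ M := by simpa [hN] using hM
    obtain ⟨p, hpC, hpM⟩ := Finset.not_subset.mp hM'.2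
    refine ⟨p, hpC, fun c hc hpc => ?_⟩
    by_contra hcc
    have hcN : c ∈ N := by simp only [hN, Finset.mem_filter_univ]; exact ⟨hc, hcc⟩
    have hcM : c ≤ M := by
      rcases hy.total hc hM'.1 with h | h
      · exact h
      · exact hmax hcN h
    exact hpM (hcM hpc)

theorem baryFun_injective_aux {y z : PosetSd P → ℝ} (hy0 : ∀ c, 0 ≤ y c)
    (hz : IsChain (· ≤ ·) {c | z c ≠ 0})
    (C : PosetSd P) (hC : ∀ c, C < c → y c = z c) (hlt : z C < y C) :
    baryFun y ≠ baryFun z := by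
  classical
  obtain ⟨p, hpC, hp⟩ := exists_mem_forall_le hz C
  intro h
  refine absurd (congrFun h p) (ne_of_gt ?_)
  refine Finset.sum_lt_sum (fun c _ => ?_) ⟨C, Finset.mem_univ _, ?_⟩
  · by_cases hpc : p ∈ c.finset
    · rw [if_pos hpc, if_pos hpc]
      refine div_le_div_of_nonneg_right ?_ (card_pos c).le
      by_cases hzc : z c = 0
      · rw [hzc]; exact hy0 c
      · rcases (hp c hzc hpc).eq_or_lt with h1 | h1
        · rw [← h1]; exact hlt.le
        · exact (hC c h1).ge
    · rw [if_neg hpc, if_neg hpc]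
  · rw [if_pos hpC, if_pos hpC]
    exact div_lt_div_of_pos_right hlt (card_pos C)

theorem baryFun_injective {y z : PosetSd P → ℝ} (hy0 : ∀ c, 0 ≤ y c) (hz0 : ∀ c, 0 ≤ z c)
    (hy : IsChain (· ≤ ·) {c | y c ≠ 0}) (hz : IsChain (· ≤ ·) {c | z c ≠ 0})
    (h : baryFun y = baryFun z) : y = z := by
  classical
  by_contra hne
  obtain ⟨c₀, hc₀⟩ := Function.ne_iff.mp hne
  obtain ⟨C, hC, hmax⟩ := ({c | y c ≠ z c} : Finset (PosetSd P)).exists_maximal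
    ⟨c₀, by simpa using hc₀⟩
  have hC' : y C ≠ z C := by simpa using hC
  have hgt : ∀ c, C < c → y c = z c := by
    intro c hc
    by_contra hcne
    exact hc.not_ge (hmax (by simpa using hcne) hc.le)
  rcases lt_or_gt_of_ne hC' with hlt | hlt
  · exact baryFun_injective_aux hz0 hy C (fun c hc => (hgt c hc).symm) hlt h.symm
  · exact baryFun_injective_aux hy0 hz C hgt hlt h

theorem baryFun_surjective_aux (n : ℕ) : ∀ x : P → ℝ, (∀ p, 0 ≤ x p) →
    IsChain (· ≤ ·) {p | x p ≠ 0} → Set.ncard {p | x p ≠ 0} ≤ n →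
    ∃ y : PosetSd P → ℝ, (∀ c, 0 ≤ y c) ∧ IsChain (· ≤ ·) {c | y c ≠ 0} ∧
      (∀ c, y c ≠ 0 → ∀ p ∈ c.finset, x p ≠ 0) ∧ baryFun y = x := by
  classical
  induction n with
  | zero =>
    intro x _ _ hn
    have hx : ∀ p, x p = 0 := by
      intro p
      by_contra hp
      have he := (Set.ncard_eq_zero (Set.toFinite _)).mp (Nat.le_zero.mp hn)
      have : p ∈ {p | x p ≠ 0} := hp
      rw [he] at this
      exact this
    refine ⟨fun _ => 0, fun _ => le_rfl, fun a ha => absurd rfl ha, fun a ha => absurd rfl ha, ?_⟩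
    funext p
    simp [baryFun, hx]
  | succ n ih =>
    intro x hx0 hx hn
    set S : Finset P := {p | x p ≠ 0} with hS
    have hmemS : ∀ p, p ∈ S ↔ x p ≠ 0 := fun p => by simp [hS]
    rcases S.eq_empty_or_nonempty with h0 | hne
    · refine ih x hx0 hx ?_
      have : {p | x p ≠ 0} = ∅ := by
        ext p
        have := hmemS p
        simp only [h0, Finset.notMem_empty, false_iff] at this
        simpa using this
      rw [this]
      simp
    · obtain ⟨q, hqS, hqmin⟩ := S.exists_min_image x hne
      set C : PosetSd P := ⟨S, hne, fun a b =>
        hx.total ((hmemS _).mp a.2) ((hmemS _).mp b.2)⟩ with hCdef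
      set x' : P → ℝ := fun p => if p ∈ S then x p - x q else 0 with hx'
      have hsub : ∀ p, x' p ≠ 0 → p ∈ S ∧ p ≠ q := by
        intro p hp
        by_cases hpS : p ∈ S
        · refine ⟨hpS, ?_⟩
          rintro rfl
          simp [hx'] at hp
        · simp [hx', hpS] at hp
      have hqpos : 0 < x q := lt_of_le_of_ne (hx0 q) ((hmemS q).mp hqS).symm
      obtain ⟨y, hy0, hyc, hysub, hyx⟩ := ih x'
        (fun p => by
          by_cases hpS : p ∈ S
          · simp only [hx', if_pos hpS]
            linarith [hqmin p hpS]
          · simp [hx', hpS])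
        (fun a ha b hb hab => hx ((hmemS a).mp (hsub a ha).1) ((hmemS b).mp (hsub b hb).1) hab)
        (by
          have hlt : Set.ncard {p | x' p ≠ 0} < Set.ncard {p | x p ≠ 0} := by
            refine Set.ncard_lt_ncard ⟨fun p hp => (hmemS p).mp (hsub p hp).1, fun hss => ?_⟩
              (Set.toFinite _)
            exact (hsub q (hss ((hmemS q).mp hqS))).2 rfl
          omega)
      have hyC : ∀ c, y c ≠ 0 → c ≤ C := fun c hc p hp => (hsub p (hysub c hc p hp)).1
      have hyC0 : y C = 0 := by
        by_contra hne0
        exact (hsub q (hysub C hne0 q hqS)).2 rfl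
      refine ⟨fun c => y c + if c = C then x q * (C.finset.card : ℝ) else 0, ?_, ?_, ?_, ?_⟩
      · intro c
        have := hy0 c
        have := card_pos C
        dsimp only
        split_ifs <;> positivity
      · intro a ha b hb hab
        by_cases haC : a = C
        · right
          rw [haC]
          refine hyC b ?_
          have hbC : b ≠ C := fun h => hab (haC.trans h.symm)
          simpa [hbC] using hb
        · have ha' : y a ≠ 0 := by simpa [haC] using ha
          by_cases hbC : b = C
          · rw [hbC]
            exact Or.inl (hyC a ha')
          · have hb' : y b ≠ 0 := by simpa [hbC] using hb
            exact hyc ha' hb' hab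
      · intro c hc p hp
        by_cases hcC : c = C
        · subst hcC
          exact (hmemS p).mp hp
        · have hc' : y c ≠ 0 := by simpa [hcC] using hc
          exact (hmemS p).mp (hyC c hc' hp)
      · funext p
        have h1 : baryFun (fun c => y c + if c = C then x q * (C.finset.card : ℝ) else 0) p =
            baryFun y p + if p ∈ C.finset then x q else 0 := by
          unfold baryFun
          have hsplit : ∀ c : PosetSd P,
              (if p ∈ c.finset then
                (y c + if c = C then x q * (C.finset.card : ℝ) else 0) / (c.finset.card : ℝ)
                else 0) =
              (if p ∈ c.finset then y c / (c.finset.card : ℝ) else 0) +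
                if c = C then (if p ∈ C.finset then x q else 0) else 0 := by
            intro c
            have hcp := card_pos c
            by_cases hpc : p ∈ c.finset
            · by_cases hcC : c = C
              · subst hcC
                simp only [hpc, if_true]
                field_simp
              · simp [hpc, hcC]
            · by_cases hcC : c = C
              · subst hcC
                simp [hpc]
              · simp [hpc, hcC]
          rw [Finset.sum_congr rfl fun c _ => hsplit c, Finset.sum_add_distrib,
            Finset.sum_ite_eq' Finset.univ C, if_pos (Finset.mem_univ C)]
        rw [h1, hyx]
        change x' p + (if p ∈ S then x q else 0) = x p
        by_cases hpS : p ∈ S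
        · simp [hx', hpS]
        · have : x p = 0 := by
            by_contra h
            exact hpS ((hmemS p).mpr h)
          simp [hx', hpS, this]

/-- The canonical map `|sd P| → |P|`, sending the vertex `c` of `|sd P|` to the barycenter of the
simplex of `|P|` spanned by the chain `c` and affine on every simplex of `|sd P|`. -/
noncomputable def baryMap (y : PosetRealization (PosetSd P)) : PosetRealization P :=
  ⟨⟨baryFun y.coord, fun p => baryFun_nonneg (fun c => y.1.2.1 c) p,
    (sum_baryFun _).trans y.1.2.2⟩, isChain_baryFun y.2⟩

theorem baryMap_bijective : Function.Bijective (baryMap (P := P)) := by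
  constructor
  · intro y z h
    refine PosetRealization.coord_injective (baryFun_injective (fun c => y.1.2.1 c)
      (fun c => z.1.2.1 c) y.2 z.2 ?_)
    exact congrArg PosetRealization.coord h
  · intro x
    obtain ⟨y, hy0, hyc, -, hyx⟩ := baryFun_surjective_aux _ x.coord (fun p => x.1.2.1 p) x.2 le_rfl
    refine ⟨⟨⟨y, hy0, ?_⟩, hyc⟩, PosetRealization.coord_injective hyx⟩
    rw [← sum_baryFun, hyx]
    exact x.1.2.2

theorem continuous_baryMap : Continuous (baryMap (P := P)) := by
  classical
  refine Continuous.subtype_mk (Continuous.subtype_mk (continuous_pi fun p => ?_) _) _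
  refine continuous_finsetSum _ fun c _ => ?_
  by_cases hpc : p ∈ c.finset
  · simp only [if_pos hpc]
    exact ((continuous_apply c).comp PosetRealization.continuous_coord).div_const _
  · simp only [if_neg hpc]
    exact continuous_const

end

/-- The canonical homeomorphism `|sd P| ≅ |P|`. -/
noncomputable def homeo (P : Type*) [Fintype P] [PartialOrder P] :
    PosetRealization (PosetSd P) ≃ₜ PosetRealization P :=
  Continuous.homeoOfEquivCompactToT2 (f := Equiv.ofBijective baryMap baryMap_bijective)
    continuous_baryMap

end PosetSd

/-! ## Equivariant homotopy inverses -/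

/-- A continuous map between `G`-spaces that commutes with the actions. -/
def IsEquivariantMap (G : Type*) {X Y : Type*} [TopologicalSpace X] [TopologicalSpace Y]
    [SMul G X] [SMul G Y] (f : C(X, Y)) : Prop :=
  ∀ (g : G) (x : X), f (g • x) = g • f x

/-- `f` and `g` are mutually inverse `G`-homotopy equivalences: both are equivariant and both
composites are homotopic to the identity through equivariant maps. -/
structure AreEquivariantHomotopyInverses (G : Type*) {X Y : Type*} [TopologicalSpace X]
    [TopologicalSpace Y] [SMul G X] [SMul G Y] (f : C(X, Y)) (g : C(Y, X)) : Prop where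
  equivariant_left : IsEquivariantMap G f
  equivariant_right : IsEquivariantMap G g
  homotopic_left : (g.comp f).HomotopicWith (ContinuousMap.id X) (IsEquivariantMap G)
  homotopic_right : (f.comp g).HomotopicWith (ContinuousMap.id Y) (IsEquivariantMap G)

/-! ## Double orders -/

/-- A strict partial order is semi-linear if it is induced by a surjection onto a finite linearly
ordered set `{1 < ... < l}`. -/
def IsSemiLinear {A : Type*} (r : A → A → Prop) : Prop :=
  ∃ (l : ℕ) (h : A → Fin l), Function.Surjective h ∧ ∀ a b, r a b ↔ h a < h b

/-- A double order: a pair of strict partial orders such that any two distinct elements are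
comparable by at least one of them. -/
@[ext]
structure DoubleOrder (A : Type*) where
  x : A → A → Prop
  y : A → A → Prop
  strict_x : IsStrictOrder A x
  strict_y : IsStrictOrder A y
  comparable : ∀ a b, a ≠ b → x a b ∨ x b a ∨ y a b ∨ y b a

namespace DoubleOrder

variable {A : Type*}

/-- Regular double orders. -/
def IsRegular (d : DoubleOrder A) : Prop :=
  IsSemiLinear d.x ∧ ∀ a b, d.x a b → ¬ d.y a b ∧ ¬ d.y b a

/-- Semi-regular double orders: the finite (nonempty) unions of regular ones, where the union of
strict partial orders is the transitive closure of the union of relations. -/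
def IsSemiRegular (d : DoubleOrder A) : Prop :=
  ∃ (k : ℕ) (e : Fin (k + 1) → DoubleOrder A), (∀ i, (e i).IsRegular) ∧
    d.x = Relation.TransGen (fun a b => ∃ i, (e i).x a b) ∧
    d.y = Relation.TransGen (fun a b => ∃ i, (e i).y a b)

/-- The relation `a (r \ s) b`: `a r b` and `a`, `b` are not comparable by `s`. -/
def relDiff (r s : A → A → Prop) (a b : A) : Prop := r a b ∧ ¬ s a b ∧ ¬ s b a

/-- The double order `d σ`, with `a (r σ) b ↔ σ a r σ b` for both relations. -/
def permute (d : DoubleOrder A) (σ : Equiv.Perm A) : DoubleOrder A where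
  x a b := d.x (σ a) (σ b)
  y a b := d.y (σ a) (σ b)
  strict_x :=
    { irrefl := fun a => d.strict_x.irrefl (σ a)
      trans := fun a b c => d.strict_x.trans (σ a) (σ b) (σ c) }
  strict_y :=
    { irrefl := fun a => d.strict_y.irrefl (σ a)
      trans := fun a b c => d.strict_y.trans (σ a) (σ b) (σ c) }
  comparable a b h := d.comparable (σ a) (σ b) (fun h' => h (σ.injective h'))

theorem permute_one (d : DoubleOrder A) : d.permute 1 = d := rfl

theorem permute_mul (d : DoubleOrder A) (σ τ : Equiv.Perm A) :
    d.permute (σ * τ) = (d.permute σ).permute τ := rfl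

theorem IsRegular.permute {d : DoubleOrder A} (hd : d.IsRegular) (σ : Equiv.Perm A) :
    (d.permute σ).IsRegular := by
  obtain ⟨⟨l, h, hs, hh⟩, hd2⟩ := hd
  exact ⟨⟨l, h ∘ σ, hs.comp σ.surjective, fun a b => hh (σ a) (σ b)⟩,
    fun a b => hd2 (σ a) (σ b)⟩

theorem transGen_permute (r : A → A → Prop) (σ : Equiv.Perm A) (a b : A) :
    Relation.TransGen r (σ a) (σ b) ↔ Relation.TransGen (fun a b => r (σ a) (σ b)) a b := by
  constructor
  · intro h
    have := Relation.TransGen.lift (p := fun a b => r (σ a) (σ b)) (σ.symm : A → A)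
      (fun a b hab => by simpa [Function.onFun] using hab) _ _ h
    simp only [Function.onFun, Equiv.symm_apply_apply] at this
    exact this
  · exact fun h => Relation.TransGen.lift (p := r) σ (fun _ _ hab => hab) _ _ h

theorem IsSemiRegular.permute {d : DoubleOrder A} (hd : d.IsSemiRegular) (σ : Equiv.Perm A) :
    (d.permute σ).IsSemiRegular := by
  obtain ⟨k, e, he, hx, hy⟩ := hd
  refine ⟨k, fun i => (e i).permute σ, fun i => (he i).permute σ, ?_, ?_⟩
  · funext a b
    change d.x (σ a) (σ b) = _
    rw [hx]
    exact propext (transGen_permute _ σ a b)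
  · funext a b
    change d.y (σ a) (σ b) = _
    rw [hy]
    exact propext (transGen_permute _ σ a b)

instance [Finite A] : Finite (DoubleOrder A) :=
  Finite.of_injective (fun d : DoubleOrder A => (d.x, d.y)) fun d e h => by
    simp only [Prod.mk.injEq] at h
    exact DoubleOrder.ext h.1 h.2

end DoubleOrder

/-- The set `R(A)` of regular double orders. -/
@[ext]
structure RegularDoubleOrder (A : Type*) extends DoubleOrder A where
  regular : toDoubleOrder.IsRegular

/-- The set `R⁺(A)` of semi-regular double orders. -/
@[ext]
structure SemiRegularDoubleOrder (A : Type*) extends DoubleOrder A where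
  semiRegular : toDoubleOrder.IsSemiRegular

namespace RegularDoubleOrder

variable {A : Type*}

theorem toDoubleOrder_injective :
    Function.Injective (toDoubleOrder : RegularDoubleOrder A → DoubleOrder A) :=
  fun _ _ h => RegularDoubleOrder.ext (congrArg DoubleOrder.x h) (congrArg DoubleOrder.y h)

/-- The order `⊑` on `R(A)`: `d ⊑ e` iff `d.x ⊆ e.x` and `d.y ⊇ e.y`. -/
instance : PartialOrder (RegularDoubleOrder A) where
  le d e := (∀ a b, d.x a b → e.x a b) ∧ ∀ a b, e.y a b → d.y a b
  le_refl _ := ⟨fun _ _ h => h, fun _ _ h => h⟩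
  le_trans _ _ _ h k := ⟨fun a b t => k.1 a b (h.1 a b t), fun a b t => h.2 a b (k.2 a b t)⟩
  le_antisymm _ _ h k := RegularDoubleOrder.ext
    (funext fun a => funext fun b => propext ⟨h.1 a b, k.1 a b⟩)
    (funext fun a => funext fun b => propext ⟨k.2 a b, h.2 a b⟩)

noncomputable instance [Finite A] : Fintype (RegularDoubleOrder A) :=
  @Fintype.ofFinite _ (Finite.of_injective _ toDoubleOrder_injective)

/-- The right action of the permutations of `A`, as a left action of the opposite group:
`op σ • d = d σ`. -/
instance : MulAction (Equiv.Perm A)ᵐᵒᵖ (RegularDoubleOrder A) where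
  smul σ d := ⟨d.toDoubleOrder.permute σ.unop, d.regular.permute σ.unop⟩
  one_smul _ := rfl
  mul_smul _ _ _ := rfl

instance : CovariantClass (Equiv.Perm A)ᵐᵒᵖ (RegularDoubleOrder A) (· • ·) (· ≤ ·) where
  elim σ _ _ h :=
    ⟨fun a b => h.1 (σ.unop a) (σ.unop b), fun a b => h.2 (σ.unop a) (σ.unop b)⟩

end RegularDoubleOrder

namespace SemiRegularDoubleOrder

variable {A : Type*}

theorem toDoubleOrder_injective :
    Function.Injective (toDoubleOrder : SemiRegularDoubleOrder A → DoubleOrder A) :=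
  fun _ _ h => SemiRegularDoubleOrder.ext (congrArg DoubleOrder.x h) (congrArg DoubleOrder.y h)

/-- The order `⊆` on `R⁺(A)`: `d ⊆ e` iff `d.x ⊆ e.x` and `d.y ⊆ e.y`. -/
instance : PartialOrder (SemiRegularDoubleOrder A) where
  le d e := (∀ a b, d.x a b → e.x a b) ∧ ∀ a b, d.y a b → e.y a b
  le_refl _ := ⟨fun _ _ h => h, fun _ _ h => h⟩
  le_trans _ _ _ h k := ⟨fun a b t => k.1 a b (h.1 a b t), fun a b t => k.2 a b (h.2 a b t)⟩
  le_antisymm _ _ h k := SemiRegularDoubleOrder.ext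
    (funext fun a => funext fun b => propext ⟨h.1 a b, k.1 a b⟩)
    (funext fun a => funext fun b => propext ⟨h.2 a b, k.2 a b⟩)

noncomputable instance [Finite A] : Fintype (SemiRegularDoubleOrder A) :=
  @Fintype.ofFinite _ (Finite.of_injective _ toDoubleOrder_injective)

/-- The right action of the permutations of `A`, as a left action of the opposite group:
`op σ • d = d σ`. -/
instance : MulAction (Equiv.Perm A)ᵐᵒᵖ (SemiRegularDoubleOrder A) where
  smul σ d := ⟨d.toDoubleOrder.permute σ.unop, d.semiRegular.permute σ.unop⟩
  one_smul _ := rfl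
  mul_smul _ _ _ := rfl

instance : CovariantClass (Equiv.Perm A)ᵐᵒᵖ (SemiRegularDoubleOrder A) (· • ·) (· ≤ ·) where
  elim σ _ _ h :=
    ⟨fun a b => h.1 (σ.unop a) (σ.unop b), fun a b => h.2 (σ.unop a) (σ.unop b)⟩

end SemiRegularDoubleOrder

namespace DoubleOrder

variable {A : Type*}

theorem negTrans_of_isSemiLinear {r : A → A → Prop} (h : IsSemiLinear r) {a c : A} (hac : r a c)
    (b : A) : r a b ∨ r b c := by
  obtain ⟨l, f, -, hf⟩ := h
  rw [hf] at hac
  rw [hf, hf]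
  exact (lt_or_ge (f a) (f b)).imp id (fun hba => lt_of_le_of_lt hba hac)

theorem isSemiLinear_of_negTrans [Finite A] {r : A → A → Prop} (hr : IsStrictOrder A r)
    (h : ∀ a b c, r a c → r a b ∨ r b c) : IsSemiLinear r := by
  classical
  have := Fintype.ofFinite A
  let f : A → ℕ := fun a => (Finset.univ.filter fun b => r b a).card
  have hlt : ∀ a b, r a b → f a < f b := by
    intro a b hab
    refine Finset.card_lt_card ⟨fun c hc => ?_, fun hss => ?_⟩
    · simp only [Finset.mem_filter_univ] at hc ⊢
      exact hr.trans c a b hc hab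
    · have : a ∈ Finset.univ.filter fun c => r c a := hss (by simpa using hab)
      exact hr.irrefl a (by simpa using this)
  have hle : ∀ a b, ¬ r a b → f b ≤ f a := by
    intro a b hab
    refine Finset.card_le_card fun c hc => ?_
    simp only [Finset.mem_filter_univ] at hc ⊢
    exact (h c a b hc).resolve_right hab
  have hiff : ∀ a b, r a b ↔ f a < f b := fun a b =>
    ⟨hlt a b, fun hab => by_contra fun hn => absurd (hle a b hn) (not_le.mpr hab)⟩
  let T : Finset ℕ := Finset.univ.image f
  let e := T.orderIsoOfFin rfl
  refine ⟨T.card, fun a => e.symm ⟨f a, Finset.mem_image_of_mem f (Finset.mem_univ a)⟩, ?_, ?_⟩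
  · intro i
    obtain ⟨a, -, ha⟩ := Finset.mem_image.mp (e i).2
    refine ⟨a, ?_⟩
    rw [OrderIso.symm_apply_eq]
    exact Subtype.ext ha
  · intro a b
    rw [hiff, e.symm.lt_iff_lt]
    exact Iff.rfl

theorem IsSemiRegular.isSemiLinear_x [Finite A] {d : DoubleOrder A} (hd : d.IsSemiRegular) :
    IsSemiLinear d.x := by
  refine isSemiLinear_of_negTrans d.strict_x ?_
  obtain ⟨k, e, he, hx, -⟩ := hd
  rw [hx]
  intro a b c hac
  induction hac with
  | single h =>
    obtain ⟨i, hi⟩ := h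
    exact (negTrans_of_isSemiLinear (he i).1 hi b).imp (fun t => .single ⟨i, t⟩) (fun t => .single ⟨i, t⟩)
  | tail _ h ih =>
    rcases ih with h1 | h1
    · exact Or.inl h1
    · exact Or.inr (h1.tail h)

/-- The double order `(x, y \ x)`, for `x` semi-linear. -/
def reduce (d : DoubleOrder A) (hd : IsSemiLinear d.x) : DoubleOrder A where
  x := d.x
  y := relDiff d.y d.x
  strict_x := d.strict_x
  strict_y :=
    { irrefl := fun a h => d.strict_y.irrefl a h.1
      trans := fun a b c hab hbc =>
        ⟨d.strict_y.trans a b c hab.1 hbc.1,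
          fun h => (negTrans_of_isSemiLinear hd h b).elim hab.2.1 hbc.2.1,
          fun h => (negTrans_of_isSemiLinear hd h b).elim hbc.2.2 hab.2.2⟩ }
  comparable a b hab := by
    by_cases h1 : d.x a b
    · exact Or.inl h1
    by_cases h2 : d.x b a
    · exact Or.inr (Or.inl h2)
    rcases d.comparable a b hab with h | h | h | h
    · exact absurd h h1
    · exact absurd h h2
    · exact Or.inr (Or.inr (Or.inl ⟨h, h1, h2⟩))
    · exact Or.inr (Or.inr (Or.inr ⟨h, h2, h1⟩))

/-- The order-preserving map `F : (R⁺(A), ⊆) → (R(A), ⊑)`, `(x, y) ↦ (x, y \ x)`. -/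
def mapF (A : Type*) [Finite A] : SemiRegularDoubleOrder A →o RegularDoubleOrder A where
  toFun d := ⟨d.toDoubleOrder.reduce d.semiRegular.isSemiLinear_x,
    d.semiRegular.isSemiLinear_x, fun _ _ hx => ⟨fun h => h.2.1 hx, fun h => h.2.2 hx⟩⟩
  monotone' := by
    intro d e hde
    refine ⟨hde.1, ?_⟩
    rintro a b ⟨hy, hx1, hx2⟩
    have n1 : ¬ d.x a b := fun h => hx1 (hde.1 a b h)
    have n2 : ¬ d.x b a := fun h => hx2 (hde.1 b a h)
    have hab : a ≠ b := by
      rintro rfl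
      exact e.strict_y.irrefl a hy
    refine ⟨?_, n1, n2⟩
    rcases d.comparable a b hab with h | h | h | h
    · exact absurd h n1
    · exact absurd h n2
    · exact h
    · exact absurd (e.strict_y.trans a b a hy (hde.2 b a h)) (e.strict_y.irrefl a)

/-- The union of the double orders of a chain in `(R(A), ⊑)`. -/
def chainUnion (c : PosetSd (RegularDoubleOrder A)) : DoubleOrder A where
  x a b := ∃ d ∈ c.finset, d.x a b
  y a b := ∃ d ∈ c.finset, d.y a b
  strict_x :=
    { irrefl := fun a ⟨d, _, h⟩ => d.strict_x.irrefl a h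
      trans := by
        rintro p q r ⟨d, hd, h⟩ ⟨e, he, k⟩
        rcases c.comparable ⟨d, hd⟩ ⟨e, he⟩ with t | t
        · exact ⟨e, he, e.strict_x.trans p q r (t.1 p q h) k⟩
        · exact ⟨d, hd, d.strict_x.trans p q r h (t.1 q r k)⟩ }
  strict_y :=
    { irrefl := fun a ⟨d, _, h⟩ => d.strict_y.irrefl a h
      trans := by
        rintro p q r ⟨d, hd, h⟩ ⟨e, he, k⟩
        rcases c.comparable ⟨d, hd⟩ ⟨e, he⟩ with t | t
        · exact ⟨d, hd, d.strict_y.trans p q r h (t.2 q r k)⟩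
        · exact ⟨e, he, e.strict_y.trans p q r (t.2 p q h) k⟩ }
  comparable a b hab := by
    obtain ⟨d, hd⟩ := c.nonempty
    exact (d.comparable a b hab).imp (fun h => ⟨d, hd, h⟩) (Or.imp (fun h => ⟨d, hd, h⟩)
      (Or.imp (fun h => ⟨d, hd, h⟩) (fun h => ⟨d, hd, h⟩)))

theorem transGen_of_isStrictOrder {r : A → A → Prop} (hr : IsStrictOrder A r) :
    Relation.TransGen r = r :=
  have := hr.toIsTrans
  Relation.transGen_eq_self

theorem chainUnion_isSemiRegular (c : PosetSd (RegularDoubleOrder A)) :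
    (chainUnion c).IsSemiRegular := by
  have hpos : c.finset.card - 1 + 1 = c.finset.card :=
    Nat.sub_add_cancel c.nonempty.card_pos
  let φ : Fin (c.finset.card - 1 + 1) ≃ c.finset := (finCongr hpos).trans c.finset.equivFin.symm
  refine ⟨c.finset.card - 1, fun i => (φ i).1.toDoubleOrder, fun i => (φ i).1.regular, ?_, ?_⟩
  · have h : (fun a b => ∃ i, (φ i).1.x a b) = (chainUnion c).x := by
      funext a b
      refine propext ⟨fun ⟨i, hi⟩ => ⟨(φ i).1, (φ i).2, hi⟩, fun ⟨d, hd, hi⟩ => ?_⟩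
      exact ⟨φ.symm ⟨d, hd⟩, by simpa using hi⟩
    rw [h, transGen_of_isStrictOrder (chainUnion c).strict_x]
  · have h : (fun a b => ∃ i, (φ i).1.y a b) = (chainUnion c).y := by
      funext a b
      refine propext ⟨fun ⟨i, hi⟩ => ⟨(φ i).1, (φ i).2, hi⟩, fun ⟨d, hd, hi⟩ => ?_⟩
      exact ⟨φ.symm ⟨d, hd⟩, by simpa using hi⟩
    rw [h, transGen_of_isStrictOrder (chainUnion c).strict_y]

/-- The order-preserving map `G : sd (R(A), ⊑) → (R⁺(A), ⊆)`, sending a chain `d₀ ⊏ ... ⊏ d_r` to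
the union of its members, i.e. to `(x_r, y_0)`. -/
def mapG (A : Type*) : PosetSd (RegularDoubleOrder A) →o SemiRegularDoubleOrder A where
  toFun c := ⟨chainUnion c, chainUnion_isSemiRegular c⟩
  monotone' _ _ h := ⟨fun _ _ ⟨d, hd, k⟩ => ⟨d, h hd, k⟩, fun _ _ ⟨d, hd, k⟩ => ⟨d, h hd, k⟩⟩

/-- On a chain with greatest element `t` and least element `s`, `G` has the value `(t.x, s.y)`. -/
theorem mapG_eq (c : PosetSd (RegularDoubleOrder A)) {s t : RegularDoubleOrder A}
    (hs : s ∈ c.finset) (ht : t ∈ c.finset) (hsc : ∀ d ∈ c.finset, s ≤ d)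
    (htc : ∀ d ∈ c.finset, d ≤ t) : (mapG A c).x = t.x ∧ (mapG A c).y = s.y :=
  ⟨funext fun a => funext fun b =>
      propext ⟨fun ⟨d, hd, h⟩ => (htc d hd).1 a b h, fun h => ⟨t, ht, h⟩⟩,
    funext fun a => funext fun b =>
      propext ⟨fun ⟨d, hd, h⟩ => (hsc d hd).2 a b h, fun h => ⟨s, hs, h⟩⟩⟩

/-- The realized map `|F| : |(R⁺(A), ⊆)| → |(R(A), ⊑)|`. -/
noncomputable def realF (A : Type*) [Finite A] :
    C(PosetRealization (SemiRegularDoubleOrder A), PosetRealization (RegularDoubleOrder A)) :=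
  PosetRealization.map (mapF A)

/-- The composite `|(R(A), ⊑)| ≅ |sd (R(A), ⊑)| → |(R⁺(A), ⊆)|` of the inverse of the canonical
homeomorphism and `|G|`. -/
noncomputable def realG (A : Type*) [Finite A] :
    C(PosetRealization (RegularDoubleOrder A), PosetRealization (SemiRegularDoubleOrder A)) :=
  (PosetRealization.map (mapG A)).comp
    ((PosetSd.homeo (RegularDoubleOrder A)).symm :
      C(PosetRealization (RegularDoubleOrder A),
        PosetRealization (PosetSd (RegularDoubleOrder A))))

end DoubleOrder

/-!
Two maps into `|Q|` that carry every point into a common simplex are homotopic along straight lines,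
and equivariantly so if both are equivariant. This single principle yields all homotopies below.

If `f ≤ g : P → Q`, replace `f` by `g` on one rank of `P` after the other, beginning with the
highest. Consecutive maps differ only on an antichain, so their realizations are homotopic in this
way, and `|f| ≃ |g|`. In the same way the canonical homeomorphism `|sd P| ≅ |P|` is homotopic to the
realization of the last vertex map `sd P → P`, and it is natural in `P` up to homotopy.

It follows that order-preserving maps `f : P → Q` and `k : sd Q → P` realize to inverse homotopy
equivalences whenever `f ∘ k` and `k ∘ sd f` are bounded above by the last vertex maps of `Q` and
`P`. For `F` and `G` both bounds are immediate from the definitions.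
-/

section Equivariant

variable {G X Y Z : Type*} [TopologicalSpace X] [TopologicalSpace Y] [TopologicalSpace Z]
  [SMul G X] [SMul G Y] [SMul G Z]

namespace IsEquivariantMap

theorem comp {k : C(Y, Z)} {f : C(X, Y)} (hk : IsEquivariantMap G k)
    (hf : IsEquivariantMap G f) : IsEquivariantMap G (k.comp f) := fun g x => by
  rw [ContinuousMap.comp_apply, hf, hk, ContinuousMap.comp_apply]

theorem homeomorph_symm {e : X ≃ₜ Y} (he : IsEquivariantMap G (e : C(X, Y))) :
    IsEquivariantMap G (e.symm : C(Y, X)) := fun g y => by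
  have h : e (g • e.symm y) = g • e (e.symm y) := he g (e.symm y)
  rw [e.apply_symm_apply] at h
  exact e.symm_apply_eq.2 h.symm

theorem homotopicWith_comp_left {k : C(Y, Z)} (hk : IsEquivariantMap G k) {f₀ f₁ : C(X, Y)}
    (h : f₀.HomotopicWith f₁ (IsEquivariantMap G)) :
    (k.comp f₀).HomotopicWith (k.comp f₁) (IsEquivariantMap G) :=
  h.map fun H => ⟨(ContinuousMap.Homotopy.refl k).comp H.toHomotopy, fun t => hk.comp (H.prop t)⟩

theorem homotopicWith_comp_right {j : C(X, Y)} (hj : IsEquivariantMap G j) {f₀ f₁ : C(Y, Z)}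
    (h : f₀.HomotopicWith f₁ (IsEquivariantMap G)) :
    (f₀.comp j).HomotopicWith (f₁.comp j) (IsEquivariantMap G) :=
  h.map fun H => ⟨H.toHomotopy.compContinuousMap j, fun t => comp (H.prop t) hj⟩

theorem homotopicWith_of_comp_homeomorph {e : X ≃ₜ Y}
    (he : IsEquivariantMap G (e : C(X, Y))) {f₀ f₁ : C(Y, Z)}
    (h : (f₀.comp (e : C(X, Y))).HomotopicWith (f₁.comp (e : C(X, Y))) (IsEquivariantMap G)) :
    f₀.HomotopicWith f₁ (IsEquivariantMap G) := by
  simpa only [ContinuousMap.comp_assoc, Homeomorph.toContinuousMap_comp_symm,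
    ContinuousMap.comp_id] using he.homeomorph_symm.homotopicWith_comp_right h

end IsEquivariantMap

end Equivariant

namespace PosetRealization

section Carrier

variable {P Q R : Type*} [Fintype P] [PartialOrder P] [Fintype Q] [PartialOrder Q]
  [Fintype R] [PartialOrder R]

/-- The elements of `P` at which the barycentric coordinates of `x` do not vanish, i.e. the
vertices of the smallest simplex of `|P|` containing `x`. -/
def carrier (x : PosetRealization P) : Set P :=
  Function.support x.coord

theorem isChain_carrier (x : PosetRealization P) : IsChain (· ≤ ·) x.carrier :=
  x.2

theorem coord_nonneg (x : PosetRealization P) (p : P) : 0 ≤ x.coord p :=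
  x.1.2.1 p

open scoped Classical in
theorem coord_map (f : P →o Q) (x : PosetRealization P) (q : Q) :
    (map f x).coord q = ∑ p with f p = q, x.coord p :=
  FunOnFinite.linearMap_apply_apply ℝ ℝ f x.coord q

theorem carrier_map (f : P →o Q) (x : PosetRealization P) :
    (map f x).carrier = f '' x.carrier := by
  classical
  ext q
  simp only [carrier, Function.mem_support, coord_map, Set.mem_image, ne_eq,
    Finset.sum_eq_zero_iff_of_nonneg fun p _ => coord_nonneg x p, Finset.mem_filter_univ]
  grind

theorem map_comp (g : Q →o R) (f : P →o Q) : (map g).comp (map f) = map (g.comp f) :=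
  ContinuousMap.ext fun x => Subtype.ext (stdSimplex.map_comp_apply f g x.1)

end Carrier

section Action

variable {G P Q : Type*} [Group G] [Fintype P] [PartialOrder P] [MulAction G P]
  [CovariantClass G P (· • ·) (· ≤ ·)] [Fintype Q] [PartialOrder Q] [MulAction G Q]
  [CovariantClass G Q (· • ·) (· ≤ ·)]

theorem coord_smul (g : G) (x : PosetRealization P) (p : P) :
    (g • x).coord p = x.coord (g⁻¹ • p) := by
  classical
  have hfibre : ({q | g • q = p} : Finset P) = {g⁻¹ • p} := by
    ext q
    simp [eq_inv_smul_iff]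
  exact (coord_map (smulHom g) x p).trans
    ((congrArg (Finset.sum · x.coord) hfibre).trans (Finset.sum_singleton _ _))

theorem isEquivariantMap_map {f : P →o Q} (hf : ∀ (g : G) (p : P), f (g • p) = g • f p) :
    IsEquivariantMap G (map f) := fun g x => by
  change (map f).comp (map (smulHom g)) x = (map (smulHom g)).comp (map f) x
  rw [map_comp, map_comp, show f.comp (smulHom g) = (smulHom g).comp f from OrderHom.ext _ _
    (funext (hf g))]

end Action

section Contiguous

variable {X Q : Type*} [TopologicalSpace X] [Fintype Q] [PartialOrder Q]

/-- Two maps into `|Q|` are contiguous if they carry every point into a common simplex. -/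
def Contiguous (f₀ f₁ : C(X, PosetRealization Q)) : Prop :=
  ∀ x, IsChain (· ≤ ·) ((f₀ x).carrier ∪ (f₁ x).carrier)

theorem Contiguous.of_carrier_subset {f₀ f₁ : C(X, PosetRealization Q)}
    (h : ∀ x, (f₀ x).carrier ⊆ (f₁ x).carrier) : Contiguous f₀ f₁ := fun x => by
  rw [Set.union_eq_self_of_subset_left (h x)]
  exact isChain_carrier _

/-- The straight-line homotopy between two contiguous maps. -/
def Contiguous.homotopy {f₀ f₁ : C(X, PosetRealization Q)} (h : Contiguous f₀ f₁) :
    f₀.Homotopy f₁ where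
  toFun z := ⟨⟨AffineMap.lineMap (f₀ z.2).coord (f₁ z.2).coord (z.1 : ℝ),
      (convex_stdSimplex ℝ Q).lineMap_mem (f₀ z.2).1.2 (f₁ z.2).1.2 z.1.2⟩,
    (h z.2).mono fun q hq => by
      by_contra hn
      obtain ⟨h₀, h₁⟩ : (f₀ z.2).coord q = 0 ∧ (f₁ z.2).coord q = 0 := by
        simpa [carrier] using hn
      refine hq ((AffineMap.pi_lineMap_apply _ _ _ _).trans ?_)
      rw [h₀, h₁, AffineMap.lineMap_same_apply]⟩
  continuous_toFun :=
    (((continuous_coord.comp (f₀.continuous.comp continuous_snd)).lineMap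
      (continuous_coord.comp (f₁.continuous.comp continuous_snd))
      (continuous_subtype_val.comp continuous_fst)).subtype_mk _).subtype_mk _
  map_zero_left x := coord_injective (AffineMap.lineMap_apply_zero (f₀ x).coord (f₁ x).coord)
  map_one_left x := coord_injective (AffineMap.lineMap_apply_one (f₀ x).coord (f₁ x).coord)

theorem Contiguous.coord_homotopy {f₀ f₁ : C(X, PosetRealization Q)} (h : Contiguous f₀ f₁)
    (t : unitInterval) (x : X) (q : Q) :
    (h.homotopy (t, x)).coord q = AffineMap.lineMap ((f₀ x).coord q) ((f₁ x).coord q) (t : ℝ) :=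
  AffineMap.pi_lineMap_apply _ _ _ _

theorem Contiguous.homotopicWith {G : Type*} [Group G] [SMul G X] [MulAction G Q]
    [CovariantClass G Q (· • ·) (· ≤ ·)] {f₀ f₁ : C(X, PosetRealization Q)}
    (h : Contiguous f₀ f₁) (hf₀ : IsEquivariantMap G f₀) (hf₁ : IsEquivariantMap G f₁) :
    f₀.HomotopicWith f₁ (IsEquivariantMap G) := by
  refine ⟨⟨h.homotopy, fun t g x => coord_injective (funext fun q => ?_)⟩⟩
  change (h.homotopy (t, g • x)).coord q = (g • h.homotopy (t, x)).coord q
  simp only [coord_smul, Contiguous.coord_homotopy, hf₀ g x, hf₁ g x]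

end Contiguous

section Splice

variable {P Q : Type*} [PartialOrder P] [PartialOrder Q] {f g : P →o Q} {ρ : P → ℕ}

/-- For `f ≤ g` and a rank function `ρ`, the map that is `g` on the elements of rank at least `n`
and `f` below them; it interpolates between `g` (for `n = 0`) and `f` (for large `n`). -/
def splice (hfg : f ≤ g) (hρ : StrictMono ρ) (n : ℕ) : P →o Q where
  toFun p := if n ≤ ρ p then g p else f p
  monotone' p q hpq := by
    have hρpq := hρ.monotone hpq
    dsimp only
    split_ifs with hp hq
    · exact g.monotone hpq
    · exact absurd (hp.trans hρpq) hq
    · exact (f.monotone hpq).trans (hfg q)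
    · exact f.monotone hpq

theorem splice_apply (hfg : f ≤ g) (hρ : StrictMono ρ) (n : ℕ) (p : P) :
    splice hfg hρ n p = if n ≤ ρ p then g p else f p :=
  rfl

theorem splice_zero (hfg : f ≤ g) (hρ : StrictMono ρ) : splice hfg hρ 0 = g :=
  OrderHom.ext _ _ (funext fun p =>
    (splice_apply hfg hρ 0 p).trans (if_pos (Nat.zero_le (ρ p))))

theorem splice_of_forall_lt (hfg : f ≤ g) (hρ : StrictMono ρ) {n : ℕ} (hn : ∀ p, ρ p < n) :
    splice hfg hρ n = f :=
  OrderHom.ext _ _ (funext fun p => if_neg (hn p).not_ge)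

theorem isChain_image_le_union_image_ge (hfg : f ≤ g) (hρ : StrictMono ρ) (n : ℕ) {C : Set P}
    (hC : IsChain (· ≤ ·) C) :
    IsChain (· ≤ ·) (f '' {p ∈ C | ρ p ≤ n} ∪ g '' {p ∈ C | n ≤ ρ p}) := by
  refine isChain_union.2 ⟨f.monotone.isChain_image (hC.mono (Set.sep_subset _ _)),
    g.monotone.isChain_image (hC.mono (Set.sep_subset _ _)), ?_⟩
  rintro _ ⟨p, ⟨hpC, hp⟩, rfl⟩ _ ⟨q, ⟨hqC, hq⟩, rfl⟩ -
  have hpq : p ≤ q := (hC.total hpC hqC).elim id fun hqp =>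
    (hqp.eq_or_lt.resolve_right fun hlt => (hρ hlt).not_ge (hp.trans hq)).ge
  exact Or.inl ((hfg p).trans (g.monotone hpq))

theorem contiguous_map_splice [Fintype P] [Fintype Q] (hfg : f ≤ g) (hρ : StrictMono ρ) (n : ℕ) :
    Contiguous (map (splice hfg hρ n)) (map (splice hfg hρ (n + 1))) := fun x => by
  refine (isChain_image_le_union_image_ge hfg hρ n x.isChain_carrier).mono ?_
  rw [carrier_map, carrier_map]
  rintro _ (⟨p, hp, rfl⟩ | ⟨p, hp, rfl⟩) <;> rw [splice_apply] <;> split_ifs with hn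
  · exact Or.inr ⟨p, ⟨hp, hn⟩, rfl⟩
  · exact Or.inl ⟨p, ⟨hp, (not_le.1 hn).le⟩, rfl⟩
  · exact Or.inr ⟨p, ⟨hp, n.le_succ.trans hn⟩, rfl⟩
  · exact Or.inl ⟨p, ⟨hp, Nat.lt_succ_iff.1 (not_le.1 hn)⟩, rfl⟩

theorem strictMono_ncard_Iio [Finite P] : StrictMono fun p : P => (Set.Iio p).ncard :=
  fun _ _ h => Set.ncard_lt_ncard (Set.Iio_ssubset_Iio h)

theorem ncard_Iio_smul {G : Type*} [Group G] [MulAction G P]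
    [CovariantClass G P (· • ·) (· ≤ ·)] (g : G) (p : P) :
    (Set.Iio (g • p)).ncard = (Set.Iio p).ncard := by
  let e : P ≃o P :=
    (MulAction.toPerm g).toOrderIso (smul_mono_right g) (smul_mono_right g⁻¹)
  rw [← Set.ncard_image_of_injective (Set.Iio p) e.injective, e.image_Iio]
  rfl

theorem homotopicWith_of_le {G : Type*} [Group G] [Fintype P] [MulAction G P]
    [CovariantClass G P (· • ·) (· ≤ ·)] [Fintype Q] [MulAction G Q]
    [CovariantClass G Q (· • ·) (· ≤ ·)] (hf : ∀ (σ : G) (p : P), f (σ • p) = σ • f p)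
    (hg : ∀ (σ : G) (p : P), g (σ • p) = σ • g p) (hfg : f ≤ g) :
    (map f).HomotopicWith (map g) (IsEquivariantMap G) := by
  let s := splice hfg (strictMono_ncard_Iio (P := P))
  have hs (n : ℕ) : IsEquivariantMap G (map (s n)) := isEquivariantMap_map fun σ p => by
    simp only [s, splice_apply, ncard_Iio_smul, hf, hg, smul_ite]
  have hs_zero (n : ℕ) : (map (s n)).HomotopicWith (map (s 0)) (IsEquivariantMap G) := by
    induction n with
    | zero => exact .refl _ (hs 0)
    | succ n ih =>
      exact ((contiguous_map_splice hfg _ n).homotopicWith (hs n) (hs (n + 1))).symm.trans ih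
  have hlt (p : P) : (Set.Iio p).ncard < Nat.card P :=
    Set.ncard_lt_card fun h => lt_irrefl p (h ▸ Set.mem_univ p : p ∈ Set.Iio p)
  simpa only [s, splice_zero, splice_of_forall_lt hfg _ hlt] using hs_zero (Nat.card P)

end Splice

end PosetRealization

namespace PosetSd

open PosetRealization
open PartialOrder.NonemptyFiniteChains (orderHomMap mem_map_iff)

section Last

variable {P : Type*} [PartialOrder P]

theorem exists_isGreatest (c : PosetSd P) : ∃ p, IsGreatest (c.finset : Set P) p := by
  obtain ⟨p, hp, hmax⟩ := c.finset.exists_maximal c.nonempty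
  exact ⟨p, hp, fun q hq => (c.comparable ⟨q, hq⟩ ⟨p, hp⟩).elim id fun h => hmax hq h⟩

/-- The last vertex map `sd P → P`, sending a chain to its greatest element. -/
noncomputable def last (P : Type*) [PartialOrder P] : PosetSd P →o P where
  toFun c := (exists_isGreatest c).choose
  monotone' c d h := (exists_isGreatest c).choose_spec.mono (exists_isGreatest d).choose_spec h

theorem isGreatest_last (c : PosetSd P) : IsGreatest (c.finset : Set P) (last P c) :=
  (exists_isGreatest c).choose_spec

end Last

section Action

open scoped Pointwise

variable {G P Q : Type*} [Group G] [PartialOrder P] [MulAction G P]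
  [CovariantClass G P (· • ·) (· ≤ ·)] [PartialOrder Q] [MulAction G Q]
  [CovariantClass G Q (· • ·) (· ≤ ·)]

noncomputable instance : SMul G (PosetSd P) where
  smul g c := c.map (smulHom g)

open scoped Classical in
theorem finset_smul (g : G) (c : PosetSd P) : (g • c).finset = g • c.finset :=
  rfl

open scoped Classical in
noncomputable instance : MulAction G (PosetSd P) :=
  Function.Injective.mulAction PartialOrder.NonemptyFiniteChains.finset
    (fun _ _ => PartialOrder.NonemptyFiniteChains.ext) finset_smul

open scoped Classical in
instance : CovariantClass G (PosetSd P) (· • ·) (· ≤ ·) where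
  elim _ _ _ h := Finset.smul_finset_subset_smul_finset h

theorem last_smul (g : G) (c : PosetSd P) : last P (g • c) = g • last P c := by
  refine (isGreatest_last (g • c)).unique ?_
  classical
  rw [finset_smul, Finset.coe_smul_finset]
  exact (smul_mono_right g).map_isGreatest (isGreatest_last c)

theorem orderHomMap_smul {f : P →o Q} (hf : ∀ (g : G) (p : P), f (g • p) = g • f p)
    (g : G) (c : PosetSd P) : orderHomMap f (g • c) = g • orderHomMap f c := by
  classical exact
    PartialOrder.NonemptyFiniteChains.ext (Finset.image_smul_comm f g c.finset (hf g))

end Action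

section Homeo

variable {P Q : Type*} [Fintype P] [PartialOrder P] [Fintype Q] [PartialOrder Q]

theorem carrier_homeo (y : PosetRealization (PosetSd P)) :
    (homeo P y).carrier = ⋃ c ∈ y.carrier, (c.finset : Set P) := by
  ext p
  simp only [Set.mem_iUnion₂, exists_prop]
  refine ⟨exists_of_baryFun_ne_zero, fun ⟨c, hc, hp⟩ => ?_⟩
  have hc_pos : 0 < y.coord c := (coord_nonneg y c).lt_of_ne' hc
  refine (Finset.sum_pos' (fun d _ => ?_) ⟨c, Finset.mem_univ c, ?_⟩).ne'
  · split_ifs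
    exacts [div_nonneg (coord_nonneg y d) (card_pos d).le, le_rfl]
  · rw [if_pos (Finset.mem_coe.1 hp)]
    exact div_pos hc_pos (card_pos c)

theorem contiguous_last_homeo :
    Contiguous (map (last P)) (homeo P : C(PosetRealization (PosetSd P), PosetRealization P)) :=
  .of_carrier_subset fun y => by
    rw [carrier_map, ContinuousMap.coe_coe, carrier_homeo]
    rintro _ ⟨c, hc, rfl⟩
    exact Set.mem_biUnion hc (isGreatest_last c).1

theorem contiguous_map_comp_homeo (f : P →o Q) :
    Contiguous ((map f).comp (homeo P : C(PosetRealization (PosetSd P), PosetRealization P)))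
      ((homeo Q : C(PosetRealization (PosetSd Q), PosetRealization Q)).comp
        (map (orderHomMap f))) :=
  .of_carrier_subset fun y => by
    simp only [ContinuousMap.comp_apply, ContinuousMap.coe_coe, carrier_map, carrier_homeo]
    rintro _ ⟨p, hp, rfl⟩
    obtain ⟨c, hc, hpc⟩ := Set.mem_iUnion₂.1 hp
    exact Set.mem_biUnion (Set.mem_image_of_mem _ hc) ((mem_map_iff c f _).2 ⟨p, hpc, rfl⟩)

variable {G : Type*} [Group G] [MulAction G P] [CovariantClass G P (· • ·) (· ≤ ·)]
  [MulAction G Q] [CovariantClass G Q (· • ·) (· ≤ ·)]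

open scoped Pointwise Classical in
theorem isEquivariantMap_homeo :
    IsEquivariantMap G
      (homeo P : C(PosetRealization (PosetSd P), PosetRealization P)) := fun g y => by
  refine coord_injective (funext fun p => ?_)
  rw [coord_smul]
  change baryFun (g • y).coord p = baryFun y.coord (g⁻¹ • p)
  refine (Equiv.sum_comp (MulAction.toPerm g) _).symm.trans (Finset.sum_congr rfl fun c _ => ?_)
  simp only [MulAction.toPerm_apply, coord_smul, inv_smul_smul, finset_smul,
    Finset.card_smul_finset, Finset.inv_smul_mem_iff]

theorem last_homotopicWith_homeo :
    (map (last P)).HomotopicWith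
      (homeo P : C(PosetRealization (PosetSd P), PosetRealization P)) (IsEquivariantMap G) :=
  contiguous_last_homeo.homotopicWith (isEquivariantMap_map last_smul) isEquivariantMap_homeo

theorem map_comp_homeo_homotopicWith {f : P →o Q} (hf : ∀ (g : G) (p : P), f (g • p) = g • f p) :
    ((map f).comp (homeo P : C(PosetRealization (PosetSd P), PosetRealization P))).HomotopicWith
      ((homeo Q : C(PosetRealization (PosetSd Q), PosetRealization Q)).comp
        (map (orderHomMap f))) (IsEquivariantMap G) :=
  (contiguous_map_comp_homeo f).homotopicWith
    ((isEquivariantMap_map hf).comp isEquivariantMap_homeo)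
    (isEquivariantMap_homeo.comp (isEquivariantMap_map (orderHomMap_smul hf)))

theorem map_homotopicWith_homeo_of_le_last {l : PosetSd P →o P}
    (hl : ∀ (g : G) (c : PosetSd P), l (g • c) = g • l c) (hle : l ≤ last P) :
    (map l).HomotopicWith
      (homeo P : C(PosetRealization (PosetSd P), PosetRealization P)) (IsEquivariantMap G) :=
  (homotopicWith_of_le hl last_smul hle).trans last_homotopicWith_homeo

theorem areEquivariantHomotopyInverses_of_le_last {f : P →o Q} {k : PosetSd Q →o P}
    (hf : ∀ (g : G) (p : P), f (g • p) = g • f p)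
    (hk : ∀ (g : G) (c : PosetSd Q), k (g • c) = g • k c)
    (hkf : k.comp (orderHomMap f) ≤ last P) (hfk : f.comp k ≤ last Q) :
    AreEquivariantHomotopyInverses G (map f)
      ((map k).comp ((homeo Q).symm : C(PosetRealization Q, PosetRealization (PosetSd Q)))) := by
  set κ := (map k).comp ((homeo Q).symm : C(PosetRealization Q, PosetRealization (PosetSd Q)))
    with hκ_def
  have hκ : IsEquivariantMap G κ :=
    (isEquivariantMap_map hk).comp isEquivariantMap_homeo.homeomorph_symm
  have hκ_homeo : κ.comp (homeo Q : C(PosetRealization (PosetSd Q), PosetRealization Q)) =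
      map k := by
    rw [hκ_def, ContinuousMap.comp_assoc, Homeomorph.symm_comp_toContinuousMap,
      ContinuousMap.comp_id]
  have hfk_homotopic := map_homotopicWith_homeo_of_le_last
    (fun (g : G) c => (congrArg f (hk g c)).trans (hf g (k c))) hfk
  have hkf_homotopic := map_homotopicWith_homeo_of_le_last
    (fun (g : G) c => (congrArg k (orderHomMap_smul hf g c)).trans (hk g _)) hkf
  refine ⟨isEquivariantMap_map hf, hκ, isEquivariantMap_homeo.homotopicWith_of_comp_homeomorph ?_,
    isEquivariantMap_homeo.homotopicWith_of_comp_homeomorph ?_⟩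
  · have h := hκ.homotopicWith_comp_left (map_comp_homeo_homotopicWith hf)
    rw [← ContinuousMap.comp_assoc, ← ContinuousMap.comp_assoc, hκ_homeo, map_comp] at h
    exact h.trans hkf_homotopic
  · rw [ContinuousMap.comp_assoc, hκ_homeo, map_comp]
    exact hfk_homotopic

end Homeo

end PosetSd

namespace DoubleOrder

open PartialOrder.NonemptyFiniteChains (orderHomMap mem_map_iff)

variable {A : Type*}

theorem mapF_smul [Finite A] (σ : (Equiv.Perm A)ᵐᵒᵖ) (d : SemiRegularDoubleOrder A) :
    mapF A (σ • d) = σ • mapF A d :=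
  rfl

theorem mapG_smul (σ : (Equiv.Perm A)ᵐᵒᵖ) (c : PosetSd (RegularDoubleOrder A)) :
    mapG A (σ • c) = σ • mapG A c := by
  have hmem (r : RegularDoubleOrder A → Prop) :
      (∃ d ∈ (σ • c).finset, r d) ↔ ∃ d ∈ c.finset, r (σ • d) := by
    classical
    simp [PosetSd.finset_smul, Finset.mem_smul_finset]
  exact SemiRegularDoubleOrder.ext
    (funext fun a => funext fun b => propext (hmem fun d => d.x a b))
    (funext fun a => funext fun b => propext (hmem fun d => d.y a b))

theorem mapF_comp_mapG_le_last [Finite A] :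
    (mapF A).comp (mapG A) ≤ PosetSd.last (RegularDoubleOrder A) := by
  intro c
  obtain ⟨hlast, hle⟩ := PosetSd.isGreatest_last c
  have hx {a b : A} : (mapG A c).x a b → (PosetSd.last _ c).x a b :=
    fun ⟨_, hd, h⟩ => (hle hd).1 a b h
  have hxy := (PosetSd.last _ c).regular.2
  exact ⟨fun _ _ => hx, fun a b hy =>
    ⟨⟨_, hlast, hy⟩, fun h => (hxy a b (hx h)).1 hy, fun h => (hxy b a (hx h)).2 hy⟩⟩

theorem mapG_comp_orderHomMap_mapF_le_last [Finite A] :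
    (mapG A).comp (orderHomMap (mapF A)) ≤ PosetSd.last (SemiRegularDoubleOrder A) := by
  intro c
  have hle {d} (hd : d ∈ (c.map (mapF A)).finset) :
      (∀ a b, d.x a b → (PosetSd.last _ c).x a b) ∧
        ∀ a b, d.y a b → (PosetSd.last _ c).y a b := by
    obtain ⟨e, he, rfl⟩ := (mem_map_iff c (mapF A) d).1 hd
    obtain ⟨hx, hy⟩ := (PosetSd.isGreatest_last c).2 he
    exact ⟨hx, fun a b h => hy a b h.1⟩
  exact ⟨fun a b ⟨_, hd, h⟩ => (hle hd).1 a b h, fun a b ⟨_, hd, h⟩ => (hle hd).2 a b h⟩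

end DoubleOrder

theorem propositionp (A : Type*) [Finite A] :
    AreEquivariantHomotopyInverses (Equiv.Perm A)ᵐᵒᵖ
      (DoubleOrder.realF A) (DoubleOrder.realG A) :=
  PosetSd.areEquivariantHomotopyInverses_of_le_last DoubleOrder.mapF_smul DoubleOrder.mapG_smul
    DoubleOrder.mapG_comp_orderHomMap_mapF_le_last DoubleOrder.mapF_comp_mapG_le_last
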